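/- Let $m\le n$ and $T$ be non-negative integers. Let $\hat Y=[\hat Y_T\ \ \hat Y_B]$ be a fixed real $T\times n$ matrix of base forecasts, with $\hat Y_T$ of size $T\times(n-m)$ (upper levels) and $\hat Y_B$ of size $T\times m$ (bottom level), and let $S_T$ be a fixed real $(n-m)\times m$ matrix (top-level summation matrix). Put $X_1=\hat Y_T-\hat Y_BS_T^\top$ and assume $\operatorname{rank}(X_1)=n-m$. Let $\Sigma_r$ be a positive semidefinite $m\times m$ matrix and $\beta_T\in\mathbb R^{m(n-m)}$, and suppose that the random $T\times m$ matrix $Y$ of bottom-level observations, with rows $y_1^\top,\dots,y_T^\top$, follows the Gaussian regression model $$y_t-\hat y_{B,t}=\bigl[I_m\otimes(\hat y_{T,t}^\top-\hat y_{B,t}^\top S_T^\top)\bigr]\beta_T+\epsilon_t,\qquad \epsilon_1,\dots,\epsilon_T\ \text{i.i.d.}\ N(0,\Sigma_r),$$ where $\hat y_{T,t}^\top$ and $\hat y_{B,t}^\top$ are the $t$-th rows of $\hat Y_T$ and $\hat Y_B$. Let $\hat\beta_T=\operatorname{vec}\bigl((X_1^\top X_1)^{-1}X_1^\top(Y-\hat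 Y_B)\bigr)$, let $\tilde Y$ be the $T\times m$ matrix of reconciled bottom-level forecasts, with rows $\tilde y_t^\top$, $\tilde y_t=\hat y_{B,t}+[I_m\otimes(\hat y_{T,t}^\top-\hat y_{B,t}^\top S_T^\top)]\hat\beta_T$, and let $e_t=y_t-\tilde y_t$. For an integer $d\ge 0$ let $W_m(\Sigma_r,d)$ be the Wishart distribution with $d$ degrees of freedom, i.e. the law of $Z^\top Z$, where $Z$ is a $d\times m$ matrix whose rows are i.i.d. $N(0,\Sigma_r)$. Then: 1. $(Y-\tilde Y)^\top(Y-\tilde Y)\sim W_m(\Sigma_r,\,T-(n-m))$. 2. If $T>n-m$, the REML estimator $\hat\Sigma_{r,\mathrm{REML}}=\frac{1}{T-(n-m)}\sum_{t=1}^Te_te_t^\top$ is integrable and is a central (unbiased) estimator of $\Sigma_r$: $E[\hat\Sigma_{r,\mathrm{REML}}]=\Sigma_r$. 3. If in addition $\beta_T=0$, then $(\tilde Y-\hat Y_B)^\top(\tilde Y-\hat Y_B)\sim W_m(\Sigma_r,\,n-m)$. -/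

import Mathlib

open MeasureTheory ProbabilityTheory Matrix
open scoped Kronecker

/-- Real matrices carry the product (that is, Borel) σ-algebra of their entries. -/
instance matrixMeasurableSpace {k l : ℕ} : MeasurableSpace (Matrix (Fin k) (Fin l) ℝ) :=
  inferInstanceAs (MeasurableSpace (Fin k → Fin l → ℝ))

/-- The Wishart distribution `W_p(Σ, d)` with scale matrix `Σ` and `d` degrees of freedom:
the law of `Zᵀ Z`, where the `d` rows of the `d × p` matrix `Z` are i.i.d. `N(0, Σ)`.
No relation between `d` and `p` is required. -/
noncomputable def wishart {p : ℕ} (Sig : Matrix (Fin p) (Fin p) ℝ) (d : ℕ) :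
    Measure (Matrix (Fin p) (Fin p) ℝ) :=
  (Measure.pi fun _ : Fin d => multivariateGaussian (0 : EuclideanSpace ℝ (Fin p)) Sig).map
    fun z => (Matrix.of fun i j => z i j)ᵀ * Matrix.of fun i j => z i j

namespace Reconciliation

variable {n m T : ℕ}

/-- The `T × (n - m)` regressor matrix `X₁ = Ŷ_T - Ŷ_B S_Tᵀ`, where `Ŷ = [Ŷ_T  Ŷ_B]` holds the base
forecasts (top levels first, bottom level last) and `S_T` is the top-level summation matrix. -/
noncomputable def regressors (S_T : Matrix (Fin (n - m)) (Fin m) ℝ)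
    (Yhat : Matrix (Fin T) (Fin (n - m) ⊕ Fin m) ℝ) : Matrix (Fin T) (Fin (n - m)) ℝ :=
  Yhat.toCols₁ - Yhat.toCols₂ * S_Tᵀ

/-- The `m × m (n - m)` design matrix `I_m ⊗ (ŷ_{T,t}ᵀ - ŷ_{B,t}ᵀ S_Tᵀ)` at time `t`. -/
noncomputable def designAt (S_T : Matrix (Fin (n - m)) (Fin m) ℝ)
    (Yhat : Matrix (Fin T) (Fin (n - m) ⊕ Fin m) ℝ) (t : Fin T) :
    Matrix (Fin m) (Fin m × Fin (n - m)) ℝ :=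
  ((1 : Matrix (Fin m) (Fin m) ℝ) ⊗ₖ
    Matrix.replicateRow Unit (regressors S_T Yhat t)).submatrix (fun i => (i, ())) id

/-- The Gaussian regression model with coherency constraints: the base forecasts `Ŷ` are fixed and
`y_t - ŷ_{B,t} = [I_m ⊗ (ŷ_{T,t}ᵀ - ŷ_{B,t}ᵀ S_Tᵀ)] β_T + ε_t`, with `ε_t` i.i.d. `N(0, Σ_r)`.
The row of `Y` with index `t` is `y_tᵀ`. -/
structure IsGaussianRegression {Ω : Type*} [MeasurableSpace Ω] (P : Measure Ω)
    (S_T : Matrix (Fin (n - m)) (Fin m) ℝ) (Yhat : Matrix (Fin T) (Fin (n - m) ⊕ Fin m) ℝ)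
    (beta_T : Fin m × Fin (n - m) → ℝ) (Sig_r : Matrix (Fin m) (Fin m) ℝ)
    (eps : Fin T → Ω → EuclideanSpace ℝ (Fin m)) (Y : Ω → Matrix (Fin T) (Fin m) ℝ) : Prop where
  model : ∀ t ω, Y ω t - Yhat.toCols₂ t = designAt S_T Yhat t *ᵥ beta_T + (eps t ω).ofLp
  law : ∀ t, HasLaw (eps t) (multivariateGaussian 0 Sig_r) P
  indep : iIndepFun eps P

/-- The estimate of the coefficients in matrix form,
`β̂_Tᵐ = (X₁ᵀ X₁)⁻¹ X₁ᵀ (Y - Ŷ_B)`, a matrix of size `(n - m) × m`. -/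
noncomputable def betaHat (S_T : Matrix (Fin (n - m)) (Fin m) ℝ)
    (Yhat : Matrix (Fin T) (Fin (n - m) ⊕ Fin m) ℝ) (Y : Matrix (Fin T) (Fin m) ℝ) :
    Matrix (Fin (n - m)) (Fin m) ℝ :=
  ((regressors S_T Yhat)ᵀ * regressors S_T Yhat)⁻¹ * (regressors S_T Yhat)ᵀ * (Y - Yhat.toCols₂)

/-- The reconciled bottom-level forecasts `Ỹ`: row by row,
`ỹ_t = ŷ_{B,t} + [I_m ⊗ (ŷ_{T,t}ᵀ - ŷ_{B,t}ᵀ S_Tᵀ)] β̂_T` with `β̂_T = vec β̂_Tᵐ`. -/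
noncomputable def reconciled (S_T : Matrix (Fin (n - m)) (Fin m) ℝ)
    (Yhat : Matrix (Fin T) (Fin (n - m) ⊕ Fin m) ℝ) (Y : Matrix (Fin T) (Fin m) ℝ) :
    Matrix (Fin T) (Fin m) ℝ :=
  Matrix.of fun t => Yhat.toCols₂ t + designAt S_T Yhat t *ᵥ vec (betaHat S_T Yhat Y)

/-- The REML estimate `(T - (n - m))⁻¹ ∑ₜ e_t e_tᵀ`, where `e_t = y_t - ỹ_t` are the residuals. -/
noncomputable def sigmaREML (S_T : Matrix (Fin (n - m)) (Fin m) ℝ)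
    (Yhat : Matrix (Fin T) (Fin (n - m) ⊕ Fin m) ℝ) (Y : Matrix (Fin T) (Fin m) ℝ) :
    Matrix (Fin m) (Fin m) ℝ :=
  ((T : ℝ) - ((n : ℝ) - (m : ℝ)))⁻¹ •
    ∑ t, vecMulVec (Y t - reconciled S_T Yhat Y t) (Y t - reconciled S_T Yhat Y t)

end Reconciliation

/-!
Let `X` be the regressor matrix, `H = X (Xᵀ X)⁻¹ Xᵀ` its hat matrix and `E` the matrix whose rows
are the errors, so that `Y - Ŷ_B = X B + E`. Full column rank of `X` makes `Xᵀ X` invertible, and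
then `H` is the orthogonal projection onto the column space of `X`, with `H X = X`. Hence the
residuals are `Y - Ỹ = (1 - H) E`, and `Ỹ - Ŷ_B = H E` when the coefficients vanish; the two Gram
matrices are `Eᵀ (1 - H) E` and `Eᵀ H E`.

An orthogonal projection `M` of rank `d` is `Qᵀ Q` with `Q` a `d`-row matrix such that `Q Qᵀ = 1`
(`Matrix.exists_transpose_mul_self_eq_of_isIdempotentElem`), so `Eᵀ M E = (Q E)ᵀ (Q E)`. The rows of
`Q E` are again i.i.d. with the law of the errors
(`ProbabilityTheory.map_coisometry_pi_multivariateGaussian`), so `Eᵀ M E` has the Wishart law with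
`d` degrees of freedom (`ProbabilityTheory.hasLaw_wishart_of_isIdempotentElem`). The ranks of `H`
and `1 - H` are `n - m` and `T - (n - m)`.

The REML estimate is the residual Gram matrix divided by its degrees of freedom, so it is unbiased
because the mean of `W_p(S, d)` is `d • S` (`ProbabilityTheory.integrable_and_integral_wishart`).
-/

/-! ### Orthogonal projections and the hat matrix -/

namespace Matrix

variable {ι κ : Type*} [Fintype ι] [Fintype κ] [DecidableEq κ]

lemma rank_one_sub_of_isIdempotentElem [DecidableEq ι] {H : Matrix ι ι ℝ} (hH : IsIdempotentElem H) :
    (1 - H).rank = Fintype.card ι - H.rank := by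
  have hidem : IsIdempotentElem H.mulVecLin := by
    rw [IsIdempotentElem, Module.End.mul_eq_comp, ← mulVecLin_mul, hH.eq]
  have hker : (1 - H).mulVecLin = 1 - H.mulVecLin := by
    refine LinearMap.ext fun x => ?_
    simp
  have hdim := H.mulVecLin.finrank_range_add_finrank_ker
  rw [LinearMap.IsIdempotentElem.ker_eq_range_one_sub hidem, ← hker] at hdim
  simp only [Module.finrank_fintype_fun_eq_card] at hdim
  unfold rank
  omega

/-- An orthogonal projection of rank `d` factors as `Qᵀ Q` through a coisometry `Q` onto `ℝᵈ`:
the rows of `Q` form an orthonormal basis of its range. -/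
lemma exists_transpose_mul_self_eq_of_isIdempotentElem [DecidableEq ι] {M : Matrix ι ι ℝ}
    (hsymm : Mᵀ = M) (hidem : IsIdempotentElem M) {d : ℕ} (hd : M.rank = d) :
    ∃ Q : Matrix (Fin d) ι ℝ, Q * Qᵀ = 1 ∧ Qᵀ * Q = M := by
  let V : Submodule ℝ (EuclideanSpace ℝ ι) := LinearMap.range (toEuclideanLin M)
  have hV : Module.finrank ℝ V = d := by
    rw [← hd, rank_eq_finrank_range_toLin M (EuclideanSpace.basisFun ι ℝ).toBasis
      (EuclideanSpace.basisFun ι ℝ).toBasis]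
    rfl
  let b : OrthonormalBasis (Fin d) ℝ V := (stdOrthonormalBasis ℝ V).reindex (finCongr hV)
  let Q : Matrix (Fin d) ι ℝ := of fun a j => (b a : EuclideanSpace ℝ ι) j
  have hQ : Q * Qᵀ = 1 := by
    ext a c
    have h := (orthonormal_iff_ite.1 b.orthonormal) c a
    rw [Submodule.coe_inner, PiLp.inner_apply] at h
    simp only [mul_apply, transpose_apply, one_apply, Q, of_apply]
    simpa [eq_comm] using h
  -- `Qᵀ Q` is the expansion in the basis `b`, so it fixes the columns of `M`, which lie in `V`.
  have hQM : Qᵀ * Q * M = M := by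
    ext i j
    have hmem : toEuclideanLin M (EuclideanSpace.single j 1) ∈ V := LinearMap.mem_range_self _ _
    have h := congrArg (fun v : V => (v : EuclideanSpace ℝ ι) i) (b.sum_repr' ⟨_, hmem⟩)
    simp only [Submodule.coe_sum, Submodule.coe_smul, WithLp.ofLp_sum, Finset.sum_apply,
      Submodule.coe_inner, PiLp.inner_apply, WithLp.ofLp_smul,
      Pi.smul_apply, smul_eq_mul] at h
    rw [Matrix.mul_assoc, mul_apply]
    simp only [transpose_apply, mul_apply, Q, of_apply]
    simpa [toLpLin_apply, mul_comm] using h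
  -- The idempotent `M` fixes its range, in particular the basis vectors.
  have hMQ : M * Qᵀ = Qᵀ := by
    ext i a
    obtain ⟨x, hx⟩ := (b a).2
    have hxi : ∀ k, (M *ᵥ x.ofLp) k = (b a : EuclideanSpace ℝ ι) k := fun k => by
      rw [← hx]; rfl
    have h : (M *ᵥ (b a : EuclideanSpace ℝ ι).ofLp) i = (b a : EuclideanSpace ℝ ι) i := by
      rw [← funext hxi, mulVec_mulVec, hidem.eq]
    simpa [mul_apply, mulVec, dotProduct, Q] using h
  refine ⟨Q, hQ, ?_⟩
  calc Qᵀ * Q = M * Qᵀ * Q := by rw [hMQ]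
    _ = M * (Qᵀ * Q) := Matrix.mul_assoc _ _ _
    _ = (Qᵀ * Q * M)ᵀ := by simp [transpose_mul, hsymm, Matrix.mul_assoc]
    _ = M := by rw [hQM, hsymm]

/-- The hat matrix `X (Xᵀ X)⁻¹ Xᵀ`, the orthogonal projection onto the column space of `X` when the
columns of `X` are linearly independent. -/
noncomputable def hatMatrix (X : Matrix ι κ ℝ) : Matrix ι ι ℝ :=
  X * (Xᵀ * X)⁻¹ * Xᵀ

lemma transpose_hatMatrix (X : Matrix ι κ ℝ) : (hatMatrix X)ᵀ = hatMatrix X := by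
  simp [hatMatrix, transpose_mul, transpose_nonsing_inv, Matrix.mul_assoc]

lemma isUnit_det_transpose_mul_self {X : Matrix ι κ ℝ} (hX : X.rank = Fintype.card κ) :
    IsUnit (Xᵀ * X).det := by
  rw [← isUnit_iff_isUnit_det, ← mulVec_surjective_iff_isUnit, ← coe_mulVecLin,
    ← LinearMap.range_eq_top]
  apply Submodule.eq_top_of_finrank_eq
  rw [Module.finrank_fintype_fun_eq_card, ← hX, ← rank_transpose_mul_self]
  rfl

/-- The hat matrix fixes the column space of `X`, so the systematic part of the model drops out of
the residuals. -/
lemma hatMatrix_mul_self {X : Matrix ι κ ℝ} (hX : X.rank = Fintype.card κ) :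
    hatMatrix X * X = X := by
  rw [hatMatrix, Matrix.mul_assoc, Matrix.mul_assoc,
    nonsing_inv_mul _ (isUnit_det_transpose_mul_self hX), Matrix.mul_one]

lemma isIdempotentElem_hatMatrix {X : Matrix ι κ ℝ} (hX : X.rank = Fintype.card κ) :
    IsIdempotentElem (hatMatrix X) := by
  rw [IsIdempotentElem]
  nth_rw 2 [hatMatrix]
  rw [← Matrix.mul_assoc, ← Matrix.mul_assoc, hatMatrix_mul_self hX, hatMatrix]

lemma rank_hatMatrix {X : Matrix ι κ ℝ} (hX : X.rank = Fintype.card κ) :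
    (hatMatrix X).rank = Fintype.card κ := by
  apply le_antisymm
  · rw [hatMatrix, Matrix.mul_assoc, ← hX]
    exact rank_mul_le_left _ _
  · calc Fintype.card κ = (hatMatrix X * X).rank := by rw [hatMatrix_mul_self hX, hX]
      _ ≤ (hatMatrix X).rank := rank_mul_le_left _ _

end Matrix

/-! ### Quadratic forms in Gaussian samples and the Wishart law -/

namespace ProbabilityTheory

open scoped RealInnerProductSpace

variable {p : ℕ} {S : Matrix (Fin p) (Fin p) ℝ}

/-- A centred i.i.d. Gaussian sample is invariant under mixing its members by the rows of a
coisometry: the joint characteristic function at `t` is `exp (-∑ₐ tₐᵀ S tₐ / 2)`, and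
`∑ₐ tₐᵀ S tₐ` does not change when `t` is replaced by `Qᵀ t`. -/
lemma map_coisometry_pi_multivariateGaussian (hS : S.PosSemidef) {k d : ℕ}
    {Q : Matrix (Fin d) (Fin k) ℝ} (hQ : Q * Qᵀ = 1) :
    (Measure.pi fun _ : Fin k => multivariateGaussian (0 : EuclideanSpace ℝ (Fin p)) S).map
        (fun z a => ∑ j, Q a j • z j) =
      Measure.pi fun _ : Fin d => multivariateGaussian (0 : EuclideanSpace ℝ (Fin p)) S := by
  have hmeas : Measurable
      (fun (z : Fin k → EuclideanSpace ℝ (Fin p)) (a : Fin d) => ∑ j, Q a j • z j) := by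
    fun_prop
  have : IsProbabilityMeasure ((Measure.pi fun _ : Fin k =>
      multivariateGaussian (0 : EuclideanSpace ℝ (Fin p)) S).map
        (fun z (a : Fin d) => ∑ j, Q a j • z j)) :=
    Measure.isProbabilityMeasure_map hmeas.aemeasurable
  rw [← charFun_eq_pi_iff]
  intro t
  -- The frequency `Qᵀ t`: pairing `t` with the mixed sample is pairing `s` with the sample itself.
  let s : PiLp 2 fun _ : Fin k => EuclideanSpace ℝ (Fin p) :=
    WithLp.toLp 2 fun j => ∑ a, Q a j • t a
  have hadj : ∀ z : Fin k → EuclideanSpace ℝ (Fin p),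
      ⟪(WithLp.toLp 2 fun a => ∑ j, Q a j • z j :
        PiLp 2 fun _ : Fin d => EuclideanSpace ℝ (Fin p)), t⟫ =
      ⟪(WithLp.toLp 2 z : PiLp 2 fun _ : Fin k => EuclideanSpace ℝ (Fin p)), s⟫ := fun z => by
    rw [PiLp.inner_apply, PiLp.inner_apply]
    simp only [s, sum_inner, inner_sum, real_inner_smul_left, real_inner_smul_right]
    exact Finset.sum_comm
  have hchar : charFun (((Measure.pi fun _ : Fin k =>
      multivariateGaussian (0 : EuclideanSpace ℝ (Fin p)) S).map
        (fun z (a : Fin d) => ∑ j, Q a j • z j)).map (WithLp.toLp 2)) t =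
      charFun ((Measure.pi fun _ : Fin k =>
        multivariateGaussian (0 : EuclideanSpace ℝ (Fin p)) S).map (WithLp.toLp 2)) s := by
    rw [Measure.map_map (by fun_prop) hmeas, charFun_apply, charFun_apply,
      integral_map (Measurable.aemeasurable (by fun_prop)) (by fun_prop),
      integral_map (Measurable.aemeasurable (by fun_prop)) (by fun_prop)]
    simp only [Function.comp_apply, hadj]
  have hform : ∑ j, (s j).ofLp ⬝ᵥ S *ᵥ (s j).ofLp = ∑ a, (t a).ofLp ⬝ᵥ S *ᵥ (t a).ofLp := by
    let t' : Matrix (Fin d) (Fin p) ℝ := Matrix.of fun a i => t a i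
    have hs : ∀ j, (s j).ofLp = (Qᵀ * t') j := fun j => by
      ext i
      simp [s, t', Matrix.mul_apply]
    have htr : ∀ {l : ℕ} (u : Matrix (Fin l) (Fin p) ℝ),
        ∑ a, u a ⬝ᵥ S *ᵥ u a = (S * (uᵀ * u)).trace := fun u => by
      rw [← Matrix.mul_assoc, Matrix.trace_mul_comm]
      simp [Matrix.trace, Matrix.mul_apply, dotProduct, Matrix.mulVec]
    simp only [hs]
    rw [htr, Matrix.transpose_mul, Matrix.transpose_transpose, Matrix.mul_assoc,
      ← Matrix.mul_assoc Q, hQ, Matrix.one_mul, ← htr]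
    rfl
  rw [hchar, charFun_pi]
  simp only [charFun_multivariateGaussian hS, inner_zero_right, Complex.ofReal_zero, zero_mul,
    zero_sub, ← Complex.exp_sum, Finset.sum_neg_distrib, ← Finset.sum_div]
  rw [← Complex.ofReal_sum, ← Complex.ofReal_sum, hform]

lemma measurable_gram (d : ℕ) : Measurable fun z : Fin d → EuclideanSpace ℝ (Fin p) =>
    (Matrix.of fun i j => z i j)ᵀ * Matrix.of fun i j => z i j := by
  refine measurable_pi_lambda _ fun i => measurable_pi_lambda _ fun j => ?_
  simp only [Matrix.mul_apply, Matrix.transpose_apply, Matrix.of_apply]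
  fun_prop

/-- Cochran's theorem for one quadratic form: if the rows of `E` are i.i.d. `N(0, S)` and `M` is an
orthogonal projection of rank `d`, then `Eᵀ M E` has the Wishart law with `d` degrees of freedom. -/
lemma hasLaw_wishart_of_isIdempotentElem (hS : S.PosSemidef) {Ω : Type*} [MeasurableSpace Ω]
    {P : Measure Ω} {k d : ℕ} {eps : Fin k → Ω → EuclideanSpace ℝ (Fin p)}
    (hlaw : ∀ t, HasLaw (eps t) (multivariateGaussian 0 S) P) (hindep : iIndepFun eps P)
    {M : Matrix (Fin k) (Fin k) ℝ} (hsymm : Mᵀ = M) (hidem : IsIdempotentElem M)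
    (hd : M.rank = d) :
    HasLaw (fun ω => (Matrix.of fun t i => eps t ω i)ᵀ * M * Matrix.of fun t i => eps t ω i)
      (wishart S d) P := by
  obtain ⟨Q, hQ, rfl⟩ := Matrix.exists_transpose_mul_self_eq_of_isIdempotentElem hsymm hidem hd
  have hmix : HasLaw (fun (z : Fin k → EuclideanSpace ℝ (Fin p)) (a : Fin d) => ∑ j, Q a j • z j)
      (Measure.pi fun _ => multivariateGaussian 0 S)
      (Measure.pi fun _ => multivariateGaussian 0 S) :=
    ⟨Measurable.aemeasurable (by fun_prop), map_coisometry_pi_multivariateGaussian hS hQ⟩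
  have hgram : HasLaw (fun z : Fin d → EuclideanSpace ℝ (Fin p) =>
      (Matrix.of fun i j => z i j)ᵀ * Matrix.of fun i j => z i j) (wishart S d)
      (Measure.pi fun _ => multivariateGaussian 0 S) :=
    ⟨(measurable_gram d).aemeasurable, rfl⟩
  convert (hgram.comp hmix).comp (hindep.hasLaw_pi hlaw) using 1
  ext1 ω
  have hQE : (Matrix.of fun (a : Fin d) i => (∑ j, Q a j • eps j ω).ofLp i) =
      Q * Matrix.of fun t i => eps t ω i := by
    ext a i
    simp [Matrix.mul_apply]
  simp only [Function.comp_apply]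
  rw [hQE, Matrix.transpose_mul]
  simp only [Matrix.mul_assoc]

lemma integrable_and_integral_mul_multivariateGaussian (hS : S.PosSemidef) (i j : Fin p) :
    Integrable (fun x : EuclideanSpace ℝ (Fin p) => x i * x j) (multivariateGaussian 0 S) ∧
      ∫ x : EuclideanSpace ℝ (Fin p), x i * x j ∂(multivariateGaussian 0 S) = S i j := by
  have hmem : ∀ l : Fin p, MemLp (fun x : EuclideanSpace ℝ (Fin p) => x l) 2
      (multivariateGaussian 0 S) := fun l =>
    (EuclideanSpace.proj (𝕜 := ℝ) l).comp_memLp' IsGaussian.memLp_two_id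
  have hmean : ∀ l : Fin p,
      ∫ x : EuclideanSpace ℝ (Fin p), x l ∂(multivariateGaussian 0 S) = 0 := fun l => by
    have h := (EuclideanSpace.proj (𝕜 := ℝ) l).integral_comp_id_comm
      (μ := multivariateGaussian (0 : EuclideanSpace ℝ (Fin p)) S) IsGaussian.integrable_id
    simpa using h
  refine ⟨(hmem i).integrable_mul (hmem j), ?_⟩
  have h := covariance_eval_multivariateGaussian (μ := 0) hS i j
  rw [covariance_eq_sub (hmem i) (hmem j), hmean i, hmean j] at h
  simpa using h

/-- The mean of the Wishart law `W_p(S, d)` is `d • S`. -/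
lemma integrable_and_integral_wishart (hS : S.PosSemidef) (d : ℕ) (i j : Fin p) :
    Integrable (fun W : Matrix (Fin p) (Fin p) ℝ => W i j) (wishart S d) ∧
      ∫ W, W i j ∂(wishart S d) = d * S i j := by
  have hentry : Measurable fun W : Matrix (Fin p) (Fin p) ℝ => W i j :=
    (measurable_pi_apply j).comp (measurable_pi_apply i)
  have hterm : ∀ a : Fin d, Integrable
      (fun z : Fin d → EuclideanSpace ℝ (Fin p) => z a i * z a j)
      (Measure.pi fun _ => multivariateGaussian 0 S) := fun a =>
    integrable_comp_eval (μ := fun _ : Fin d => multivariateGaussian 0 S)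
      (f := fun x : EuclideanSpace ℝ (Fin p) => x i * x j)
      (integrable_and_integral_mul_multivariateGaussian hS i j).1
  rw [wishart, integrable_map_measure hentry.aestronglyMeasurable (measurable_gram d).aemeasurable,
    integral_map (measurable_gram d).aemeasurable hentry.aestronglyMeasurable]
  simp only [Function.comp_def, Matrix.mul_apply, Matrix.transpose_apply, Matrix.of_apply]
  refine ⟨integrable_finsetSum _ fun a _ => hterm a, ?_⟩
  rw [integral_finsetSum _ fun a _ => hterm a]
  have hint : ∀ a : Fin d, ∫ z : Fin d → EuclideanSpace ℝ (Fin p), z a i * z a j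
      ∂(Measure.pi fun _ => multivariateGaussian 0 S) = S i j := fun a => by
    have hf := (integrable_and_integral_mul_multivariateGaussian hS i j).1.aestronglyMeasurable
    rw [← (integrable_and_integral_mul_multivariateGaussian hS i j).2]
    exact integral_comp_eval (μ := fun _ : Fin d => multivariateGaussian 0 S) (i := a)
      (f := fun x : EuclideanSpace ℝ (Fin p) => x i * x j) hf
  simp [hint]

end ProbabilityTheory

/-! ### The reconciled forecasts as projections -/

namespace Reconciliation

variable {n m T : ℕ}

lemma designAt_mulVec_vec (S_T : Matrix (Fin (n - m)) (Fin m) ℝ)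
    (Yhat : Matrix (Fin T) (Fin (n - m) ⊕ Fin m) ℝ) (B : Matrix (Fin (n - m)) (Fin m) ℝ)
    (t : Fin T) : designAt S_T Yhat t *ᵥ vec B = (regressors S_T Yhat * B) t := by
  ext i
  simp [designAt, Matrix.mulVec, dotProduct, Fintype.sum_prod_type, Matrix.mul_apply,
    Matrix.one_apply, ite_mul, vec]

/-- Stacked over time, the reconciliation projects `Y - Ŷ_B` onto the column space of the
regressors. -/
lemma reconciled_sub_bottom (S_T : Matrix (Fin (n - m)) (Fin m) ℝ)
    (Yhat : Matrix (Fin T) (Fin (n - m) ⊕ Fin m) ℝ) (Y : Matrix (Fin T) (Fin m) ℝ) :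
    reconciled S_T Yhat Y - Yhat.toCols₂ =
      hatMatrix (regressors S_T Yhat) * (Y - Yhat.toCols₂) := by
  have h : hatMatrix (regressors S_T Yhat) * (Y - Yhat.toCols₂) =
      regressors S_T Yhat * betaHat S_T Yhat Y := by
    simp only [hatMatrix, betaHat, Matrix.mul_assoc]
  ext t i
  rw [h, ← designAt_mulVec_vec]
  simp [reconciled]

lemma sigmaREML_eq_smul (S_T : Matrix (Fin (n - m)) (Fin m) ℝ)
    (Yhat : Matrix (Fin T) (Fin (n - m) ⊕ Fin m) ℝ) (Y : Matrix (Fin T) (Fin m) ℝ) :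
    sigmaREML S_T Yhat Y = ((T : ℝ) - ((n : ℝ) - (m : ℝ)))⁻¹ •
      ((Y - reconciled S_T Yhat Y)ᵀ * (Y - reconciled S_T Yhat Y)) := by
  rw [sigmaREML]
  congr 1
  ext i j
  simp [Matrix.sum_apply, vecMulVec_apply, Matrix.mul_apply]

end Reconciliation

theorem mainTheorem5 {n m T : ℕ} (hmn : m ≤ n)
    {Ω : Type*} [MeasurableSpace Ω] (P : Measure Ω) [IsProbabilityMeasure P]
    (S_T : Matrix (Fin (n - m)) (Fin m) ℝ)
    (Yhat : Matrix (Fin T) (Fin (n - m) ⊕ Fin m) ℝ)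
    (hrank : (Reconciliation.regressors S_T Yhat).rank = n - m)
    (beta_T : Fin m × Fin (n - m) → ℝ)
    (Sig_r : Matrix (Fin m) (Fin m) ℝ) (hSig : Sig_r.PosSemidef)
    (eps : Fin T → Ω → EuclideanSpace ℝ (Fin m))
    (Y : Ω → Matrix (Fin T) (Fin m) ℝ)
    (hmodel : Reconciliation.IsGaussianRegression P S_T Yhat beta_T Sig_r eps Y) :
    HasLaw (fun ω => (Y ω - Reconciliation.reconciled S_T Yhat (Y ω))ᵀ *
        (Y ω - Reconciliation.reconciled S_T Yhat (Y ω)))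
      (wishart Sig_r (T - (n - m))) P ∧
    (n - m < T → ∀ i j,
      Integrable (fun ω => Reconciliation.sigmaREML S_T Yhat (Y ω) i j) P ∧
      ∫ ω, Reconciliation.sigmaREML S_T Yhat (Y ω) i j ∂P = Sig_r i j) ∧
    (beta_T = 0 →
      HasLaw (fun ω => (Reconciliation.reconciled S_T Yhat (Y ω) - Yhat.toCols₂)ᵀ *
          (Reconciliation.reconciled S_T Yhat (Y ω) - Yhat.toCols₂))
        (wishart Sig_r (n - m)) P) := by
  let X := Reconciliation.regressors S_T Yhat
  let E : Ω → Matrix (Fin T) (Fin m) ℝ := fun ω => Matrix.of fun t i => eps t ω i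
  -- `beta_T` is the vectorisation of the coefficient matrix `B`.
  let B : Matrix (Fin (n - m)) (Fin m) ℝ := Matrix.of fun k i => beta_T (i, k)
  have hX : X.rank = Fintype.card (Fin (n - m)) := by rw [Fintype.card_fin]; exact hrank
  have hsymm : (1 - hatMatrix X)ᵀ = 1 - hatMatrix X := by
    rw [transpose_sub, transpose_one, transpose_hatMatrix]
  have hidem := isIdempotentElem_hatMatrix hX
  have hY : ∀ ω, Y ω - Yhat.toCols₂ = X * B + E ω := fun ω => by
    ext t i
    have h := congrFun (hmodel.model t ω) i
    rw [show beta_T = vec B from rfl, Reconciliation.designAt_mulVec_vec] at h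
    exact h
  have hfit : ∀ ω, Reconciliation.reconciled S_T Yhat (Y ω) - Yhat.toCols₂ =
      X * B + hatMatrix X * E ω := fun ω => by
    rw [Reconciliation.reconciled_sub_bottom, hY, Matrix.mul_add, ← Matrix.mul_assoc,
      hatMatrix_mul_self hX]
  have hres : ∀ ω, Y ω - Reconciliation.reconciled S_T Yhat (Y ω) =
      (1 - hatMatrix X) * E ω := fun ω => by
    rw [← sub_sub_sub_cancel_right (Y ω) _ Yhat.toCols₂, hY, hfit, Matrix.sub_mul, Matrix.one_mul,
      add_sub_add_left_eq_sub]
  have hgram : ∀ {M : Matrix (Fin T) (Fin T) ℝ}, Mᵀ = M → IsIdempotentElem M → ∀ ω,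
      (M * E ω)ᵀ * (M * E ω) = (E ω)ᵀ * M * E ω := fun {M} hM hM' ω => by
    rw [transpose_mul, hM, Matrix.mul_assoc, ← Matrix.mul_assoc M, hM'.eq, Matrix.mul_assoc]
  have hRSS : HasLaw (fun ω => (Y ω - Reconciliation.reconciled S_T Yhat (Y ω))ᵀ *
      (Y ω - Reconciliation.reconciled S_T Yhat (Y ω))) (wishart Sig_r (T - (n - m))) P := by
    simp only [hres, hgram hsymm hidem.one_sub]
    refine hasLaw_wishart_of_isIdempotentElem hSig hmodel.law hmodel.indep hsymm hidem.one_sub ?_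
    rw [rank_one_sub_of_isIdempotentElem hidem, rank_hatMatrix hX, Fintype.card_fin,
      Fintype.card_fin]
  refine ⟨hRSS, fun hlt i j => ?_, fun hbeta => ?_⟩
  · have hentry : Measurable fun W : Matrix (Fin m) (Fin m) ℝ => W i j :=
      (measurable_pi_apply j).comp (measurable_pi_apply i)
    obtain ⟨hint, hval⟩ := integrable_and_integral_wishart hSig (T - (n - m)) i j
    -- Neither natural-number difference is truncated, by `hmn` and `hlt`.
    have hcast : ((T - (n - m) : ℕ) : ℝ) = (T : ℝ) - ((n : ℝ) - (m : ℝ)) := by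
      rw [Nat.cast_sub hlt.le, Nat.cast_sub hmn]
    have hne : (T : ℝ) - ((n : ℝ) - (m : ℝ)) ≠ 0 := by
      rw [← hcast, Nat.cast_ne_zero]
      omega
    rw [← hRSS.map_eq] at hint
    have hint' := (integrable_map_measure hentry.aestronglyMeasurable hRSS.aemeasurable).1 hint
    have hval' := hRSS.integral_comp hentry.aestronglyMeasurable
    simp only [Reconciliation.sigmaREML_eq_smul, Matrix.smul_apply, smul_eq_mul]
    refine ⟨hint'.const_mul _, ?_⟩
    rw [integral_const_mul, show ∫ ω, ((Y ω - Reconciliation.reconciled S_T Yhat (Y ω))ᵀ *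
      (Y ω - Reconciliation.reconciled S_T Yhat (Y ω))) i j ∂P = _ from hval', hval, hcast,
      inv_mul_cancel_left₀ hne]
  · have hB : B = 0 := by
      ext k i
      simp [B, hbeta]
    simp only [hfit, hB, Matrix.mul_zero, zero_add, hgram (transpose_hatMatrix X) hidem]
    exact hasLaw_wishart_of_isIdempotentElem hSig hmodel.law hmodel.indep (transpose_hatMatrix X)
      hidem ((rank_hatMatrix hX).trans (Fintype.card_fin _))
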